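/- Let $d \ge 1$ be an integer and let $M$ be a real number. There is a constant $c = c(d,M) > 0$, depending only on $d$ and $M$, such that the following holds. Let $n \ge d$, let $X_1, \ldots, X_n$ be i.i.d. random elements in a measurable space $(S, \mathcal{S})$, and let $h \colon S^d \to \mathbb{R}$ be a measurable function (with respect to the product $\sigma$-algebra) such that $|h| \le M$. Assume that $h$ is completely degenerate, i.e. $\mathbb{E}_i\, h(X_1, \ldots, X_d) = 0$ almost surely for all $i = 1, \ldots, d$, where $\mathbb{E}_i$ denotes the expectation with respect to $X_i$ only (the other variables being held fixed). Then the $U$-statistic $$ f(X_1, \ldots, X_n) = \frac{(n-d)!}{n!} \sum h(X_{i_1}, \ldots, X_{i_d}), $$ where the sum extends over all $d$-tuples $(i_1, \ldots, i_d) \in \{1, \ldots, n\}^d$ with pairwise distinct entries, satisfies $$ \mathbb{E} \exp\left(c\, n\, |f(X_1, \ldots, X_n)|^{2/d}\right) \le 2. $$ -/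

import Mathlib

open MeasureTheory ProbabilityTheory
open scoped Nat

/-- `E_i h(X_1, …, X_d)`: the expectation of `h(X_1, …, X_d)` with respect to `X_i` alone
(integrated over the law of `X_i`), as a random variable depending on the remaining `X_j`. -/
noncomputable def partialExpectation {Ω S : Type*} [MeasurableSpace Ω] (P : Measure Ω) {d : ℕ}
    (X : Fin d → Ω → S) (h : (Fin d → S) → ℝ) (i : Fin d) : Ω → ℝ :=
  fun ω => ∫ ω', h (Function.update (fun j => X j ω) i (X i ω')) ∂P

/-- The kernel `h` is completely degenerate with respect to `X_1, …, X_d`: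
`E_i h(X_1, …, X_d) = 0` almost surely for every `i`. -/
def CompletelyDegenerate {Ω S : Type*} [MeasurableSpace Ω] (P : Measure Ω) {d : ℕ}
    (X : Fin d → Ω → S) (h : (Fin d → S) → ℝ) : Prop :=
  ∀ i : Fin d, ∀ᵐ ω ∂P, partialExpectation P X h i ω = 0

/-- The `U`-statistic of order `d` with kernel `h` at the sample point `x = (x_1, …, x_n)`, `d ≤ n`:
`(n - d)! / n!` times the sum of `h(x_{i_1}, …, x_{i_d})` over all `d`-tuples of pairwise
distinct indices (that is, over all injections from `Fin d` to `Fin n`). -/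
noncomputable def uStatistic {S : Type*} {d n : ℕ} (h : (Fin d → S) → ℝ) (x : Fin n → S) : ℝ :=
  ((n - d)! : ℝ) / (n ! : ℝ) * ∑ i : Fin d ↪ Fin n, h (fun k => x (i k))

/-!
The proof is by moments. With `Y = n * |f| ^ (2 / d)`, the power `Y ^ (k * d)` equals
`n ^ (k * d) * f ^ (2 * k)`, so even moments of `f` control the moments of `Y`.

The `2 * m`-th power of the sum of `h (X_{i_1}, …, X_{i_d})` over all injections expands into a
sum over `2 * m`-tuples of injections. If some index occurs in exactly one injection of the tuple,
integrating first over the corresponding variable gives zero by degeneracy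
(`integral_prod_kernel_eq_zero`). The remaining tuples fill `2 * m * d` slots with every index used
at least twice, so they involve at most `m * d` indices, and there are at most
`(e * n * m * d) ^ (m * d)` of them (`card_filter_card_image_le`). After normalization this yields
`E Y ^ (m * d) ≤ (C * m) ^ (m * d)` with `C = M² d³ e` (`integral_uStatistic_pow_le`), and
`E Y ^ k ≤ (C * k) ^ k` for all `k` by Jensen's inequality. Since `k ^ k ≤ e ^ k * k!`, the
exponential series of `c * Y` with `c = 1 / (2 * C * e)` is dominated by the geometric series of
ratio `1 / 2`, whose sum is `2` (`integral_exp_le_two_of_integral_pow_le`).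
-/

/-! ### Counting maps with few values -/

/-- A map none of whose fibres is a singleton takes at most half as many values as
it has arguments. -/
theorem two_mul_card_image_le {ι α : Type*} [Fintype ι] [DecidableEq ι] [DecidableEq α]
    (g : ι → α) (hg : ∀ a, ∃ b, b ≠ a ∧ g b = g a) :
    2 * (Finset.univ.image g).card ≤ Fintype.card ι := by
  refine Finset.mul_card_image_le_card_of_maps_to
    (fun a _ => Finset.mem_image_of_mem g (Finset.mem_univ a)) 2 fun y hy => ?_
  obtain ⟨a, -, rfl⟩ := Finset.mem_image.1 hy
  obtain ⟨b, hba, hb⟩ := hg a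
  exact Finset.one_lt_card.2 ⟨b, by simp [hb], a, by simp, hba⟩

/-- Among the `n ^ (2 * K)` maps from a set of size `2 * K` to `Fin n`, those with at most `K` values
number at most `(e * n * K) ^ K`. If `K ≤ n`, enlarge the image to a set of size `K`, which gives
`n.choose K * K ^ (2 * K)`, and use `K ^ K / K! ≤ e ^ K`; if `n ≤ K`, all maps together are few
enough. -/
theorem card_filter_card_image_le {ι : Type*} [Fintype ι] [DecidableEq ι] (n K : ℕ)
    (hι : Fintype.card ι = 2 * K) :
    (((Finset.univ : Finset (ι → Fin n)).filter
      fun g => (Finset.univ.image g).card ≤ K).card : ℝ) ≤ (Real.exp 1 * n * K) ^ K := by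
  rcases le_total K n with hK | hK
  -- a map with at most `K` values takes its values in a set of size exactly `K`
  · have hsub : ((Finset.univ : Finset (ι → Fin n)).filter
        fun g => (Finset.univ.image g).card ≤ K) ⊆
        (Finset.powersetCard K Finset.univ).biUnion
          fun A : Finset (Fin n) => Fintype.piFinset fun _ : ι => A := by
      intro g hg
      obtain ⟨A, hA, hAK⟩ := Finset.exists_superset_card_eq
        (Finset.mem_filter.1 hg).2 (by simpa using hK)
      simp only [Finset.mem_biUnion, Finset.mem_powersetCard, Fintype.mem_piFinset]
      exact ⟨A, ⟨Finset.subset_univ _, hAK⟩,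
        fun i => hA (Finset.mem_image_of_mem g (Finset.mem_univ i))⟩
    have hcard : ((Finset.univ : Finset (ι → Fin n)).filter
        fun g => (Finset.univ.image g).card ≤ K).card ≤ n.choose K * K ^ (2 * K) := by
      refine (Finset.card_le_card hsub).trans ?_
      refine (Finset.card_biUnion_le_card_mul _ _ (K ^ (2 * K)) ?_).trans (by simp)
      intro A hA
      simp [(Finset.mem_powersetCard.1 hA).2, hι]
    calc _ ≤ ((n.choose K * K ^ (2 * K) : ℕ) : ℝ) := by exact_mod_cast hcard
      _ = (n.choose K : ℝ) * ((K : ℝ) ^ K * (K : ℝ) ^ K) := by push_cast; ring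
      _ ≤ ((n : ℝ) ^ K / K !) * ((K : ℝ) ^ K * (K : ℝ) ^ K) := by
        gcongr; exact Nat.choose_le_pow_div K n
      _ = ((K : ℝ) ^ K / K !) * (n : ℝ) ^ K * (K : ℝ) ^ K := by ring
      _ ≤ Real.exp K * (n : ℝ) ^ K * (K : ℝ) ^ K := by
        gcongr; exact Real.pow_div_factorial_le_exp _ (by positivity) _
      _ = (Real.exp 1 * n * K) ^ K := by
        rw [mul_pow, mul_pow, ← Real.exp_nat_mul, mul_one]
  · have hcard : ((Finset.univ : Finset (ι → Fin n)).filter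
        fun g => (Finset.univ.image g).card ≤ K).card ≤ n ^ (2 * K) :=
      (Finset.card_le_univ _).trans (by simp [hι])
    calc _ ≤ ((n ^ (2 * K) : ℕ) : ℝ) := by exact_mod_cast hcard
      _ = ((1 : ℝ) * n * n) ^ K := by push_cast; rw [pow_mul]; ring
      _ ≤ (Real.exp 1 * n * K) ^ K := by
        gcongr
        exact Real.one_le_exp zero_le_one

/-! ### Product measures -/

/-- Resampling one coordinate of an i.i.d. sample leaves its law unchanged. -/
theorem measurePreserving_update {ι S : Type*} [Fintype ι] [DecidableEq ι] [MeasurableSpace S]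
    (μ : Measure S) [IsProbabilityMeasure μ] (j : ι) :
    MeasurePreserving (fun p : (ι → S) × S => Function.update p.1 j p.2)
      ((Measure.pi fun _ : ι => μ).prod μ) (Measure.pi fun _ : ι => μ) := by
  have hm : Measurable (fun p : (ι → S) × S => Function.update p.1 j p.2) := by
    refine measurable_pi_lambda _ fun i => ?_
    by_cases hi : i = j
    · subst hi; simpa using measurable_snd
    · simp only [Function.update_of_ne hi]
      fun_prop
  refine ⟨hm, (Measure.pi_eq fun s hs => ?_).symm⟩
  have hpre : (fun p : (ι → S) × S => Function.update p.1 j p.2) ⁻¹' Set.univ.pi s =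
      (Set.univ.pi (Function.update s j Set.univ)) ×ˢ s j := by
    ext ⟨x, y⟩
    simp only [Set.mem_preimage, Set.mem_pi, Set.mem_univ, forall_const, Set.mem_prod]
    constructor
    · refine fun h => ⟨fun i => ?_, by simpa using h j⟩
      by_cases hi : i = j
      · subst hi; simp
      · simpa [hi] using h i
    · rintro ⟨h, hy⟩ i
      by_cases hi : i = j
      · subst hi; simpa using hy
      · simpa [hi] using h i
  rw [Measure.map_apply hm (MeasurableSet.univ_pi hs), hpre, Measure.prod_prod, Measure.pi_pi,
    ← Finset.mul_prod_erase _ _ (Finset.mem_univ j),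
    ← Finset.mul_prod_erase _ (fun i => μ (s i)) (Finset.mem_univ j)]
  simp only [Function.update_self, measure_univ, one_mul]
  rw [mul_comm]
  congr 1
  refine Finset.prod_congr rfl fun i hi => ?_
  rw [Function.update_of_ne (Finset.ne_of_mem_erase hi)]

/-- A subfamily of an i.i.d. sample, in any order, is again an i.i.d. sample. -/
theorem measurePreserving_comp_embedding {ι κ S : Type*} [Fintype ι] [Fintype κ]
    [MeasurableSpace S] (μ : Measure S) [IsProbabilityMeasure μ] (e : κ ↪ ι) :
    MeasurePreserving (fun x : ι → S => fun k => x (e k))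
      (Measure.pi fun _ : ι => μ) (Measure.pi fun _ : κ => μ) := by
  classical
  have hm : Measurable (fun x : ι → S => fun k => x (e k)) := by fun_prop
  refine ⟨hm, (Measure.pi_eq fun s hs => ?_).symm⟩
  have hpre : (fun x : ι → S => fun k => x (e k)) ⁻¹' Set.univ.pi s =
      Set.univ.pi (fun i => ⋂ k, ⋂ _ : e k = i, s k) := by
    ext x
    simp only [Set.mem_preimage, Set.mem_pi, Set.mem_univ, forall_const, Set.mem_iInter]
    exact ⟨fun h i k hk => hk ▸ h k, fun h k => h _ k rfl⟩
  rw [Measure.map_apply hm (MeasurableSet.univ_pi hs), hpre, Measure.pi_pi,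
    ← Finset.prod_subset (Finset.subset_univ (Finset.univ.map e)), Finset.prod_map]
  · refine Finset.prod_congr rfl fun k _ => ?_
    congr 1
    ext y
    simp [e.injective.eq_iff]
  · intro i _ hi
    have : (⋂ k, ⋂ _ : e k = i, s k) = Set.univ := by
      simp only [Finset.mem_map, Finset.mem_univ, true_and, not_exists] at hi
      simp [hi]
    rw [this, measure_univ]

/-! ### Even moments of degenerate `U`-statistics -/

/-- The expectation of a product of kernel evaluations vanishes as soon as some index `I t₀ k₀` is
used by the factor `t₀` only: integrating over that one variable first kills the factor `t₀`, by
degeneracy, while the other factors are constants. -/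
theorem integral_prod_kernel_eq_zero {τ S : Type*} [Fintype τ] [DecidableEq τ] [MeasurableSpace S]
    (μ : Measure S) [IsProbabilityMeasure μ] {d n : ℕ} {M : ℝ} {h : (Fin d → S) → ℝ}
    (hh : Measurable h) (hM : ∀ s, |h s| ≤ M)
    (hdeg : ∀ k, ∀ᵐ z ∂Measure.pi (fun _ : Fin d => μ), ∫ y, h (Function.update z k y) ∂μ = 0)
    (I : τ → Fin d ↪ Fin n) (t₀ : τ) (k₀ : Fin d)
    (hI : ∀ t k, I t k = I t₀ k₀ → t = t₀) :
    ∫ x, ∏ t, h (fun k => x (I t k)) ∂Measure.pi (fun _ : Fin n => μ) = 0 := by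
  have hmeas : Measurable fun x : Fin n → S => ∏ t, h (fun k => x (I t k)) :=
    Finset.measurable_fun_prod _ fun t _ => hh.comp (by fun_prop)
  have hmp := measurePreserving_update μ (I t₀ k₀)
  have hint : Integrable (fun x : Fin n → S => ∏ t, h (fun k => x (I t k)))
      (Measure.pi fun _ : Fin n => μ) := by
    refine Integrable.of_bound hmeas.aestronglyMeasurable (∏ _t : τ, M) (.of_forall fun x => ?_)
    rw [Real.norm_eq_abs, Finset.abs_prod]
    exact Finset.prod_le_prod (fun _ _ => abs_nonneg _) fun _ _ => hM _
  rw [← hmp.map_eq, integral_map hmp.measurable.aemeasurable hmeas.aestronglyMeasurable,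
    integral_prod _ (by exact hmp.integrable_comp_of_integrable hint)]
  have hae := (measurePreserving_comp_embedding μ (I t₀)).quasiMeasurePreserving.ae (hdeg k₀)
  rw [← integral_zero (Fin n → S) ℝ (μ := Measure.pi fun _ : Fin n => μ)]
  refine integral_congr_ae ?_
  filter_upwards [hae] with x hx
  have hfac : ∀ y, ∏ t, h (fun k => Function.update x (I t₀ k₀) y (I t k)) =
      h (Function.update (fun k => x (I t₀ k)) k₀ y) *
        ∏ t ∈ Finset.univ.erase t₀, h (fun k => x (I t k)) := by
    intro y
    rw [← Finset.mul_prod_erase _ _ (Finset.mem_univ t₀)]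
    congr 1
    · congr 1
      exact Function.update_comp_eq_of_injective x (I t₀).injective k₀ y
    · refine Finset.prod_congr rfl fun t ht => ?_
      congr 1
      funext k
      exact Function.update_of_ne (fun hk => Finset.ne_of_mem_erase ht (hI t k hk)) _ _
  simp only [hfac, integral_mul_const, hx, zero_mul]

/-- Even moments of the unnormalized `U`-statistic. Only the tuples of injections in which every
index occurring is used at least twice contribute to the expansion of the power; each contributes
at most `M ^ (2 * m)`, and they use at most `m * d` indices for their `2 * m * d` slots. -/
theorem integral_sum_kernel_pow_le {S : Type*} [MeasurableSpace S]
    (μ : Measure S) [IsProbabilityMeasure μ] {d n : ℕ} {M : ℝ} {h : (Fin d → S) → ℝ}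
    (hh : Measurable h) (hM : ∀ s, |h s| ≤ M)
    (hdeg : ∀ k, ∀ᵐ z ∂Measure.pi (fun _ : Fin d => μ), ∫ y, h (Function.update z k y) ∂μ = 0)
    (m : ℕ) :
    ∫ x, (∑ i : Fin d ↪ Fin n, h (fun k => x (i k))) ^ (2 * m) ∂Measure.pi (fun _ : Fin n => μ) ≤
      M ^ (2 * m) * (Real.exp 1 * n * (m * d : ℕ)) ^ (m * d) := by
  classical
  simp_rw [Fintype.sum_pow]
  have hbd : ∀ (I : Fin (2 * m) → Fin d ↪ Fin n) (x : Fin n → S),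
      ‖∏ t, h (fun k => x (I t k))‖ ≤ M ^ (2 * m) := by
    intro I x
    rw [Real.norm_eq_abs, Finset.abs_prod]
    exact (Finset.prod_le_prod (fun _ _ => abs_nonneg _) fun _ _ => hM _).trans (by simp)
  have hmeas : ∀ I : Fin (2 * m) → Fin d ↪ Fin n,
      Measurable fun x : Fin n → S => ∏ t, h (fun k => x (I t k)) := fun I =>
    Finset.measurable_fun_prod _ fun t _ => hh.comp (by fun_prop)
  rw [integral_finsetSum _ fun I _ => Integrable.of_bound (hmeas I).aestronglyMeasurable
    (M ^ (2 * m)) (.of_forall (hbd I))]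
  -- the tuples whose slots use at most `m * d` distinct indices
  set G : Finset (Fin (2 * m) → Fin d ↪ Fin n) := Finset.univ.filter fun I =>
    (Finset.univ.image fun p : Fin (2 * m) × Fin d => I p.1 p.2).card ≤ m * d with hG
  have hzero : ∀ I ∈ Finset.univ, I ∉ G →
      ∫ x, ∏ t, h (fun k => x (I t k)) ∂Measure.pi (fun _ : Fin n => μ) = 0 := by
    intro I _ hIG
    by_contra hne
    refine hIG (Finset.mem_filter.2 ⟨Finset.mem_univ _, ?_⟩)
    have := two_mul_card_image_le (fun p : Fin (2 * m) × Fin d => I p.1 p.2) ?_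
    · rw [Fintype.card_prod, Fintype.card_fin, Fintype.card_fin, mul_assoc] at this
      omega
    rintro ⟨t₀, k₀⟩
    by_contra! hcon
    refine hne (integral_prod_kernel_eq_zero μ hh hM hdeg I t₀ k₀ fun t k htk => ?_)
    by_contra ht
    exact hcon (t, k) (fun he => ht (congrArg Prod.fst he)) htk
  rw [← Finset.sum_subset (Finset.subset_univ G) hzero]
  have hterm : ∀ I ∈ G, ∫ x, ∏ t, h (fun k => x (I t k)) ∂Measure.pi (fun _ : Fin n => μ) ≤
      M ^ (2 * m) := fun I _ => by
    have := norm_integral_le_of_norm_le_const (μ := Measure.pi fun _ : Fin n => μ)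
      (Filter.Eventually.of_forall (hbd I))
    rw [probReal_univ, mul_one] at this
    exact (Real.le_norm_self _).trans this
  refine (Finset.sum_le_card_nsmul _ _ _ hterm).trans ?_
  rw [nsmul_eq_mul, mul_comm]
  have hMM : 0 ≤ M ^ (2 * m) := by rw [pow_mul]; positivity
  refine mul_le_mul_of_nonneg_left ?_ hMM
  refine le_trans ?_ (card_filter_card_image_le (ι := Fin (2 * m) × Fin d) n (m * d)
    (by simp [mul_assoc]))
  norm_cast
  refine Finset.card_le_card_of_injOn (fun I p => I p.1 p.2) (fun I hI => ?_) ?_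
  · simpa [hG] using hI
  · intro I _ J _ hIJ
    ext t k
    exact congrArg Fin.val (congrFun hIJ (t, k))

theorem factorial_sub_div_factorial_le {d n : ℕ} (hd : 1 ≤ d) (hdn : d ≤ n) :
    ((n - d)! : ℝ) / (n ! : ℝ) ≤ ((d : ℝ) / n) ^ d := by
  -- each factor of the descending factorial is at least `n + 1 - d`, hence at least `n / d`
  have h1 : n ≤ d * (n + 1 - d) := by
    obtain ⟨k, rfl⟩ := Nat.exists_eq_add_of_le hdn
    rw [show d + k + 1 - d = k + 1 by omega]
    nlinarith
  have h2 : n ^ d ≤ d ^ d * n.descFactorial d := by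
    calc n ^ d ≤ (d * (n + 1 - d)) ^ d := Nat.pow_le_pow_left h1 d
      _ = d ^ d * (n + 1 - d) ^ d := mul_pow _ _ _
      _ ≤ _ := Nat.mul_le_mul_left _ (Nat.pow_sub_le_descFactorial n d)
  have h3 := Nat.factorial_mul_descFactorial hdn
  have hn : 0 < n := by omega
  rw [div_pow, div_le_div_iff₀ (by positivity) (by positivity)]
  norm_cast
  calc (n - d)! * n ^ d ≤ (n - d)! * (d ^ d * n.descFactorial d) := Nat.mul_le_mul_left _ h2
    _ = d ^ d * ((n - d)! * n.descFactorial d) := by ring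
    _ = d ^ d * n ! := by rw [h3]

theorem abs_uStatistic_le {S : Type*} {d n : ℕ} (hdn : d ≤ n) {M : ℝ} {h : (Fin d → S) → ℝ}
    (hM : ∀ s, |h s| ≤ M) (x : Fin n → S) : |uStatistic h x| ≤ M := by
  have hsum : |∑ i : Fin d ↪ Fin n, h (fun k => x (i k))| ≤ n.descFactorial d * M := by
    refine (Finset.abs_sum_le_sum_abs _ _).trans
      ((Finset.sum_le_card_nsmul _ _ M fun _ _ => hM _).trans ?_)
    simp [Fintype.card_embedding_eq]
  rw [uStatistic, abs_mul, abs_of_nonneg (by positivity), ← Nat.factorial_mul_descFactorial hdn]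
  have hpos : (0 : ℝ) < n.descFactorial d := by
    exact_mod_cast Nat.descFactorial_pos.2 hdn
  push_cast
  calc _ ≤ ((n - d)! : ℝ) / ((n - d)! * n.descFactorial d) * (n.descFactorial d * M) := by gcongr
    _ = M := by field_simp

theorem measurable_uStatistic {S : Type*} [MeasurableSpace S] {d n : ℕ} {h : (Fin d → S) → ℝ}
    (hh : Measurable h) : Measurable (uStatistic (n := n) h) :=
  (Finset.measurable_fun_sum _ fun _ _ => hh.comp (by fun_prop)).const_mul _

/-- Even moments of the normalized `U`-statistic `f`: in terms of `Y = n * |f| ^ (2 / d)` this says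
that the moment of `Y` of order `m * d` is at most `(C * m) ^ (m * d)`, with `C = M² d³ e`. -/
theorem integral_uStatistic_pow_le {S : Type*} [MeasurableSpace S]
    (μ : Measure S) [IsProbabilityMeasure μ] {d n : ℕ} (hd : 1 ≤ d) (hdn : d ≤ n)
    {M : ℝ} (hM1 : 1 ≤ M) {h : (Fin d → S) → ℝ}
    (hh : Measurable h) (hM : ∀ s, |h s| ≤ M)
    (hdeg : ∀ k, ∀ᵐ z ∂Measure.pi (fun _ : Fin d => μ), ∫ y, h (Function.update z k y) ∂μ = 0)
    (m : ℕ) :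
    (n : ℝ) ^ (m * d) * ∫ x, uStatistic h x ^ (2 * m) ∂Measure.pi (fun _ : Fin n => μ) ≤
      (M ^ 2 * d ^ 3 * Real.exp 1 * m) ^ (m * d) := by
  have hn : (0 : ℝ) < n := by exact_mod_cast (show 0 < n by omega)
  simp_rw [uStatistic, mul_pow]
  rw [integral_const_mul]
  have hS := integral_sum_kernel_pow_le (n := n) μ hh hM hdeg m
  have hMd : M ^ (2 * m) ≤ (M ^ 2) ^ (m * d) := by
    rw [← pow_mul]
    exact pow_le_pow_right₀ hM1 (by nlinarith)
  have hnonneg : 0 ≤ ∫ x, (∑ i : Fin d ↪ Fin n, h (fun k => x (i k))) ^ (2 * m)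
      ∂Measure.pi (fun _ : Fin n => μ) :=
    integral_nonneg fun x => by rw [pow_mul]; positivity
  calc _ ≤ (n : ℝ) ^ (m * d) * ((((d : ℝ) / n) ^ d) ^ (2 * m) *
        ((M ^ 2) ^ (m * d) * (Real.exp 1 * n * (m * d : ℕ)) ^ (m * d))) := by
        gcongr
        · exact factorial_sub_div_factorial_le hd hdn
        · exact hS.trans (by gcongr)
    _ = (n * ((d : ℝ) / n) ^ 2 * M ^ 2 * (Real.exp 1 * n * (m * d))) ^ (m * d) := by
        push_cast
        rw [← pow_mul, show d * (2 * m) = 2 * (m * d) by ring, pow_mul]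
        simp only [mul_pow]
        ring
    _ = _ := by
        rw [← mul_pow, ← mul_pow, ← mul_pow]
        congr 1
        field_simp

/-! ### From moments to exponential integrability -/

/-- Integrating the exponential series term by term, the moment bound and `k ^ k / k! ≤ e ^ k` leave
the geometric series of ratio `1 / 2`. -/
theorem integral_exp_le_two_of_integral_pow_le {Ω : Type*} [MeasurableSpace Ω] {P : Measure Ω}
    [IsProbabilityMeasure P] {Y : Ω → ℝ} (hY : ∀ k : ℕ, Integrable (fun ω => Y ω ^ k) P)
    (hY0 : ∀ ω, 0 ≤ Y ω) {C : ℝ} (hC : 0 < C) (hmom : ∀ k : ℕ, ∫ ω, Y ω ^ k ∂P ≤ (C * k) ^ k) :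
    ∫ ω, Real.exp (1 / (2 * C * Real.exp 1) * Y ω) ∂P ≤ 2 := by
  set c : ℝ := 1 / (2 * C * Real.exp 1) with hc
  have hc0 : 0 < c := by positivity
  have hint : ∀ k : ℕ, Integrable (fun ω => (c * Y ω) ^ k / (k ! : ℝ)) P := fun k => by
    simp_rw [mul_pow]
    exact ((hY k).const_mul _).div_const _
  have hle : ∀ k : ℕ, ∫ ω, (c * Y ω) ^ k / (k ! : ℝ) ∂P ≤ (1 / 2) ^ k := fun k => by
    simp_rw [mul_pow]
    rw [integral_div, integral_const_mul]
    calc _ ≤ c ^ k * (C * k) ^ k / (k ! : ℝ) := by gcongr; exact hmom k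
      _ = c ^ k * C ^ k * ((k : ℝ) ^ k / (k ! : ℝ)) := by rw [mul_pow]; ring
      _ ≤ c ^ k * C ^ k * Real.exp k := by
        gcongr; exact Real.pow_div_factorial_le_exp _ (by positivity) _
      _ = (c * C * Real.exp 1) ^ k := by
        rw [mul_pow, mul_pow, ← Real.exp_nat_mul, mul_one]
      _ = (1 / 2) ^ k := by
        congr 1
        rw [hc]
        field_simp
  have hnorm : ∀ k : ℕ, ∫ ω, ‖(c * Y ω) ^ k / (k ! : ℝ)‖ ∂P =
      ∫ ω, (c * Y ω) ^ k / (k ! : ℝ) ∂P := fun k => by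
    refine integral_congr_ae (.of_forall fun ω => Real.norm_of_nonneg ?_)
    have := hY0 ω
    positivity
  have hsummable : Summable fun k : ℕ => ∫ ω, ‖(c * Y ω) ^ k / (k ! : ℝ)‖ ∂P := by
    refine summable_geometric_two.of_nonneg_of_le
      (fun k => integral_nonneg fun _ => norm_nonneg _) fun k => ?_
    rw [hnorm]
    exact hle k
  have hsum := hasSum_integral_of_summable_integral_norm hint hsummable
  have hexp : ∀ ω, ∑' k : ℕ, (c * Y ω) ^ k / (k ! : ℝ) = Real.exp (c * Y ω) := fun ω => by
    rw [Real.exp_eq_exp_ℝ, NormedSpace.exp_eq_tsum_div]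
  simp_rw [hexp] at hsum
  exact (hasSum_le hle hsum summable_geometric_two.hasSum).trans_eq tsum_geometric_two

/-- The bound on the moment of order `k * d` passes to order `k` by Jensen's inequality. -/
theorem integral_pow_le_of_integral_pow_mul_le {Ω : Type*} [MeasurableSpace Ω] {P : Measure Ω}
    [IsProbabilityMeasure P] {Y : Ω → ℝ} (hY : ∀ k : ℕ, Integrable (fun ω => Y ω ^ k) P)
    (hY0 : ∀ ω, 0 ≤ Y ω) {C : ℝ} (hC : 0 ≤ C) {k d : ℕ} (hd : d ≠ 0)
    (hmom : ∫ ω, Y ω ^ (k * d) ∂P ≤ C ^ (k * d)) : ∫ ω, Y ω ^ k ∂P ≤ C ^ k := by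
  have hjensen := (convexOn_pow (𝕜 := ℝ) d).map_integral_le (μ := P) (f := fun ω => Y ω ^ k)
    (continuous_pow d).continuousOn isClosed_Ici
    (.of_forall fun ω => pow_nonneg (hY0 ω) k) (hY k)
    (by simpa only [Function.comp_def, ← pow_mul] using hY (k * d))
  refine le_of_pow_le_pow_left₀ hd (by positivity) (hjensen.trans ?_)
  simpa only [← pow_mul] using hmom

theorem mainTheorem5 (d : ℕ) (hd : 1 ≤ d) (M : ℝ) :
    ∃ c : ℝ, 0 < c ∧
      ∀ (n : ℕ) (hdn : d ≤ n)
        (Ω : Type*) [MeasurableSpace Ω] (P : Measure Ω) [IsProbabilityMeasure P]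
        (S : Type*) [MeasurableSpace S] (X : Fin n → Ω → S) (h : (Fin d → S) → ℝ),
        (∀ i, Measurable (X i)) →
        iIndepFun X P →
        (∀ i j, IdentDistrib (X i) (X j) P P) →
        Measurable h →
        (∀ s, |h s| ≤ M) →
        CompletelyDegenerate P (fun j : Fin d => X (Fin.castLE hdn j)) h →
        Integrable (fun ω => Real.exp
          (c * (n : ℝ) * |uStatistic h (fun i => X i ω)| ^ ((2 : ℝ) / (d : ℝ)))) P ∧
        ∫ ω, Real.exp
          (c * (n : ℝ) * |uStatistic h (fun i => X i ω)| ^ ((2 : ℝ) / (d : ℝ))) ∂P ≤ 2 := by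
  -- replacing `M` by `max M 1` allows `M ^ (2 * m)` to be absorbed in a power `m * d`
  set M' : ℝ := max M 1
  have hM1 : 1 ≤ M' := le_max_right _ _
  have hd0 : (0 : ℝ) < d := by exact_mod_cast hd
  set C : ℝ := M' ^ 2 * d ^ 3 * Real.exp 1
  have hC0 : 0 < C := by positivity
  refine ⟨1 / (2 * C * Real.exp 1), by positivity, ?_⟩
  intro n hdn Ω _ P _ S _ X h hX hind hid hh hMh hdeg
  have hbd : ∀ s, |h s| ≤ M' := fun s => (hMh s).trans (le_max_left _ _)
  set j₀ : Fin n := ⟨0, by omega⟩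
  set μ : Measure S := P.map (X j₀)
  have : IsProbabilityMeasure μ := Measure.isProbabilityMeasure_map (hX j₀).aemeasurable
  have hXμ : ∀ i, P.map (X i) = μ := fun i => (hid i j₀).map_eq
  have hXm : Measurable fun ω i => X i ω := measurable_pi_lambda _ hX
  have hlaw : P.map (fun ω i => X i ω) = Measure.pi fun _ => μ := by
    rw [(iIndepFun_iff_map_fun_eq_pi_map fun i => (hX i).aemeasurable).1 hind]
    simp_rw [hXμ]
  -- complete degeneracy, restated for the law of the first `d` observations
  have hdegμ : ∀ k, ∀ᵐ z ∂Measure.pi (fun _ : Fin d => μ),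
      ∫ y, h (Function.update z k y) ∂μ = 0 := by
    intro k
    have hmp : MeasurePreserving (fun ω j => X (Fin.castLE hdn j) ω) P
        (Measure.pi fun _ : Fin d => μ) :=
      (measurePreserving_comp_embedding μ (Fin.castLEEmb hdn)).comp ⟨hXm, hlaw⟩
    have hupd : Measurable fun p : (Fin d → S) × S => h (Function.update p.1 k p.2) :=
      hh.comp (measurePreserving_update μ k).measurable
    have hms : MeasurableSet {z : Fin d → S | ∫ y, h (Function.update z k y) ∂μ = 0} :=
      (hupd.stronglyMeasurable.integral_prod_right (ν := μ)).measurable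
        (measurableSet_singleton 0)
    rw [← hmp.map_eq, ae_map_iff hmp.measurable.aemeasurable hms]
    filter_upwards [hdeg k] with ω hω
    rw [← hXμ (Fin.castLE hdn k)]
    exact (integral_map (hX _).aemeasurable
      (hupd.comp measurable_prodMk_left).aestronglyMeasurable).trans hω
  set Y : Ω → ℝ := fun ω => n * |uStatistic h (fun i => X i ω)| ^ ((2 : ℝ) / (d : ℝ)) with hY
  have hfm : Measurable fun ω => uStatistic h (fun i => X i ω) :=
    (measurable_uStatistic hh).comp hXm
  have hYm : Measurable Y := (hfm.abs.pow_const _).const_mul _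
  have hY0 : ∀ ω, 0 ≤ Y ω := fun ω => by positivity
  have hYB : ∀ ω, Y ω ≤ n * M' ^ ((2 : ℝ) / (d : ℝ)) := fun ω => by
    have := abs_uStatistic_le hdn hbd (fun i => X i ω)
    simp only [hY]
    gcongr
  have hYint : ∀ k : ℕ, Integrable (fun ω => Y ω ^ k) P := fun k =>
    .of_bound (hYm.pow_const k).aestronglyMeasurable ((n * M' ^ ((2 : ℝ) / (d : ℝ))) ^ k)
      (.of_forall fun ω => by
        rw [Real.norm_of_nonneg (pow_nonneg (hY0 ω) k)]
        exact pow_le_pow_left₀ (hY0 ω) (hYB ω) k)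
  have hYd : ∀ k ω, Y ω ^ (k * d) = n ^ (k * d) * uStatistic h (fun i => X i ω) ^ (2 * k) := by
    intro k ω
    simp only [hY]
    rw [mul_pow, mul_comm k d, pow_mul (|_| ^ _), ← Real.rpow_mul_natCast (abs_nonneg _),
      div_mul_cancel₀ _ hd0.ne', Real.rpow_two, sq_abs, ← pow_mul]
  have hmom : ∀ k : ℕ, ∫ ω, Y ω ^ k ∂P ≤ (C * k) ^ k := fun k => by
    refine integral_pow_le_of_integral_pow_mul_le hYint hY0 (by positivity)
      (Nat.one_le_iff_ne_zero.1 hd) ?_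
    simp_rw [hYd]
    rw [integral_const_mul]
    have := integral_uStatistic_pow_le μ hd hdn hM1 hh hbd hdegμ k
    rwa [← hlaw, integral_map hXm.aemeasurable
      ((measurable_uStatistic hh).pow_const _).aestronglyMeasurable] at this
  simp_rw [mul_assoc _ (n : ℝ)]
  refine ⟨.of_bound (hYm.const_mul _).exp.aestronglyMeasurable
    (Real.exp (1 / (2 * C * Real.exp 1) * (n * M' ^ ((2 : ℝ) / (d : ℝ))))) (.of_forall fun ω => ?_),
    integral_exp_le_two_of_integral_pow_le hYint hY0 hC0 hmom⟩
  rw [Real.norm_of_nonneg (Real.exp_pos _).le, Real.exp_le_exp]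
  exact mul_le_mul_of_nonneg_left (hYB ω) (by positivity)
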